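/- Let $p\in(0,1)$. For $x>0$ let $m_p(x)>0$ be the $p$-quantile of the gamma distribution with shape parameter $x$ and scale parameter $1$, i.e. the unique positive solution of $$\int_0^{m_p(x)}e^{-t}t^{x-1}\,dt=p\,\Gamma(x),$$ and let $u_p(x)=e^{-\frac{\log p}{x}}m_p(x)$. Let $\gamma$ be Euler's constant, let $$s_1=\int_0^{e^{-\gamma}}\frac{e^{-s}-1}{s}\log s\,ds+\int_{e^{-\gamma}}^{\infty}\frac{e^{-s}}{s}\log s\,ds,$$ and let $p_k(t)=\sum_i a_{i,k}t^i$ ($k\ge 0$) be the polynomials with integer coefficients given by $\frac{d^k}{dx^k}e^{-1/x}=p_k(1/x)e^{-1/x}$, that is, $p_0=1$ and $p_{k+1}(t)=t^2(p_k(t)-p_k'(t))$. Then $m_p$ is $C^\infty$ on $(0,\infty)$, for every $j\ge 0$ the limit $u_p^{(j)}(0):=\lim_{x\to0^+}u_p^{(j)}(x)$ exists in $\mathbb R$, and for every $n\ge 0$, as $x\to 0^+$, $$e^{-\frac{\log p}{x}}m_p^{(n)}(x)=\sum_{k=0}^n\sum_{l=0}^{k}\sum_{j=0}^{2k}\binom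 nk a_{l+k,k}(-\log p)^l\,\frac{u_p^{(n-k+j)}(0)}{j!\,x^{k+l-j}}+O(x)=\sum_{k=0}^{2n}\frac{z_{k,n}}{x^k}+O(x),$$ where $z_{i,n}$ is the sum of the coefficients of all terms of the triple sum with $k+l-j=i$. Moreover $$z_{2n,n}=e^{-\gamma}(-\log p)^n\quad(n\ge0),\qquad z_{2n-1,n}=e^{-\gamma}(-\log p)^{n-1}\bigl(-s_1\log p-n(n-1)\bigr)\quad(n\ge1).$$ In particular, for every $n\ge 0$, $$m_p^{(n)}(x)\sim\frac{(-\log p)^n}{x^{2n}}\,e^{-\gamma}e^{\frac{\log p}{x}}\quad\text{as }x\to0^+.$$ -/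

import Mathlib

open scoped Topology ContDiff

noncomputable section

/-- The (unnormalised) lower incomplete gamma function `∫₀^y e^{-t} t^{x-1} dt`. -/
def lowerGamma (x y : ℝ) : ℝ := ∫ t in (0 : ℝ)..y, Real.exp (-t) * t ^ (x - 1)

/-- The `p`-quantile `m_p(x)` of the gamma distribution with shape parameter `x` and scale
parameter `1`: the solution `y > 0` of `∫₀^y e^{-t} t^{x-1} dt = p Γ(x)`, which exists and is
unique for `0 < p < 1` and `0 < x` (see `existsUnique_lowerGamma_eq` and `gammaQuantile_spec`). -/
def gammaQuantile (p x : ℝ) : ℝ := sInf {y : ℝ | 0 < y ∧ lowerGamma x y = p * Real.Gamma x}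

theorem lowerGamma_intervalIntegrable {x : ℝ} (hx : 0 < x) {a b : ℝ} (ha : 0 ≤ a) (hb : 0 ≤ b) :
    IntervalIntegrable (fun t : ℝ => Real.exp (-t) * t ^ (x - 1)) MeasureTheory.volume a b := by
  rw [intervalIntegrable_iff]
  refine (Real.GammaIntegral_convergent hx).mono_set ?_
  intro t ht
  exact lt_of_le_of_lt (le_min ha hb) ht.1

theorem lowerGamma_strictMonoOn {x : ℝ} (hx : 0 < x) :
    StrictMonoOn (lowerGamma x) (Set.Ici 0) := by
  intro a ha b hb hab
  have h := intervalIntegral.integral_interval_sub_left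
    (lowerGamma_intervalIntegrable hx le_rfl hb) (lowerGamma_intervalIntegrable hx le_rfl ha)
  have hpos : 0 < ∫ t in a..b, Real.exp (-t) * t ^ (x - 1) := by
    refine intervalIntegral.intervalIntegral_pos_of_pos_on
      (lowerGamma_intervalIntegrable hx ha hb) (fun t ht => ?_) hab
    have : 0 < t := lt_of_le_of_lt ha ht.1
    positivity
  unfold lowerGamma
  linarith

theorem existsUnique_lowerGamma_eq {p x : ℝ} (hp0 : 0 < p) (hp1 : p < 1) (hx : 0 < x) :
    ∃! y : ℝ, 0 < y ∧ lowerGamma x y = p * Real.Gamma x := by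
  have hG : 0 < Real.Gamma x := Real.Gamma_pos_of_pos hx
  have hlim : Filter.Tendsto (lowerGamma x) Filter.atTop (𝓝 (Real.Gamma x)) := by
    rw [Real.Gamma_eq_integral hx]
    exact MeasureTheory.intervalIntegral_tendsto_integral_Ioi 0
      (Real.GammaIntegral_convergent hx) Filter.tendsto_id
  have hlt : p * Real.Gamma x < Real.Gamma x := by nlinarith
  obtain ⟨b, hb, hb0⟩ :=
    ((hlim.eventually_const_lt hlt).and (Filter.eventually_gt_atTop 0)).exists
  have hcont : ContinuousOn (lowerGamma x) (Set.Icc 0 b) := by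
    have := intervalIntegral.continuousOn_primitive_interval'
      (lowerGamma_intervalIntegrable hx le_rfl hb0.le) Set.left_mem_uIcc
    rwa [Set.uIcc_of_le hb0.le] at this
  have h0 : lowerGamma x 0 = 0 := by simp [lowerGamma]
  have hmem : p * Real.Gamma x ∈ Set.Icc (lowerGamma x 0) (lowerGamma x b) :=
    ⟨by rw [h0]; positivity, hb.le⟩
  obtain ⟨y, hy, hyeq⟩ := intermediate_value_Icc hb0.le hcont hmem
  have hy0 : 0 < y := by
    rcases hy.1.eq_or_lt with h | h
    · rw [← h, h0] at hyeq
      have : 0 < p * Real.Gamma x := by positivity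
      linarith
    · exact h
  refine ⟨y, ⟨hy0, hyeq⟩, ?_⟩
  rintro z ⟨hz0, hz⟩
  exact (lowerGamma_strictMonoOn hx).injOn hz0.le hy0.le (hz.trans hyeq.symm)

theorem gammaQuantile_spec {p x : ℝ} (hp0 : 0 < p) (hp1 : p < 1) (hx : 0 < x) :
    0 < gammaQuantile p x ∧ lowerGamma x (gammaQuantile p x) = p * Real.Gamma x := by
  obtain ⟨y, hy, huniq⟩ := existsUnique_lowerGamma_eq hp0 hp1 hx
  have hset : {y : ℝ | 0 < y ∧ lowerGamma x y = p * Real.Gamma x} = {y} :=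
    Set.eq_singleton_iff_unique_mem.2 ⟨hy, huniq⟩
  have : gammaQuantile p x = y := by rw [gammaQuantile, hset, csInf_singleton]
  rw [this]
  exact hy

/-- `u_p(x) = e^{-log p / x} m_p(x)`, for `x > 0`. -/
def scaledQuantile (p x : ℝ) : ℝ := Real.exp (-(Real.log p / x)) * gammaQuantile p x

/-- `u_p^{(j)}(0)`, the limit of `u_p^{(j)}(x)` as `x → 0⁺`. -/
def scaledQuantileDerivZero (p : ℝ) (j : ℕ) : ℝ :=
  Filter.limUnder (𝓝[>] (0 : ℝ)) (iteratedDeriv j (scaledQuantile p))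

/-- The polynomials `p_k` with `∂_x^k e^{-1/x} = p_k(1/x) e^{-1/x}`
(see `iteratedDeriv_exp_neg_inv`). -/
def expInvPoly : ℕ → Polynomial ℤ
  | 0 => 1
  | k + 1 => Polynomial.X ^ 2 * (expInvPoly k - Polynomial.derivative (expInvPoly k))

theorem iteratedDeriv_exp_neg_inv (k : ℕ) {x : ℝ} (hx : x ≠ 0) :
    iteratedDeriv k (fun y : ℝ => Real.exp (-1 / y)) x
      = Polynomial.aeval (1 / x) (expInvPoly k) * Real.exp (-1 / x) := by
  induction k generalizing x with
  | zero => simp [expInvPoly]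
  | succ k ih =>
    have hev : iteratedDeriv k (fun y : ℝ => Real.exp (-1 / y)) =ᶠ[𝓝 x]
        fun y => Polynomial.aeval (y⁻¹) (expInvPoly k) * Real.exp (-y⁻¹) := by
      filter_upwards [isOpen_ne.mem_nhds hx] with y hy
      rw [ih hy, one_div, neg_div, one_div]
    rw [iteratedDeriv_succ, hev.deriv_eq]
    have h1 : HasDerivAt (fun y : ℝ => y⁻¹) (-(x ^ 2)⁻¹) x := hasDerivAt_inv hx
    have h2 := ((expInvPoly k).hasDerivAt_aeval (x⁻¹)).comp x h1
    have h3 := h1.neg.exp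
    have h4 := (h2.mul h3).deriv
    refine Eq.trans h4 ?_
    simp only [expInvPoly, map_mul, map_sub, map_pow, Polynomial.aeval_X, one_div, neg_div,
      Function.comp, Pi.neg_apply]
    field_simp
    ring

/-- The coefficient `a_{i,k}` of `t^i` in `p_k(t)`. -/
def expInvCoeff (i k : ℕ) : ℝ := ((expInvPoly k).coeff i : ℝ)

/-- The summand with indices `k, l, j` in the expansion of `e^{-log p / x} m_p^{(n)}(x)`, without
its power `x^{-(k+l-j)}`. -/
def expansionTerm (p : ℝ) (n k l j : ℕ) : ℝ :=
  (n.choose k : ℝ) * expInvCoeff (l + k) k * (-Real.log p) ^ l *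
    (scaledQuantileDerivZero p (n - k + j) / (j.factorial : ℝ))

/-- The coefficient `z_{i,n}` of `x^{-i}`: the sum of all terms with `k + l - j = i`. -/
def expansionCoeff (p : ℝ) (i n : ℕ) : ℝ :=
  ∑ k ∈ Finset.range (n + 1), ∑ l ∈ Finset.range (k + 1), ∑ j ∈ Finset.range (2 * k + 1),
    if k + l = i + j then expansionTerm p n k l j else 0

/-- `s_q = ∫₀^{e^{-γ}} (e^{-s}-1)/s (log s)^q ds + ∫_{e^{-γ}}^∞ e^{-s}/s (log s)^q ds`. -/
def sConst (q : ℕ) : ℝ :=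
  (∫ s in (0 : ℝ)..Real.exp (-Real.eulerMascheroniConstant),
      (Real.exp (-s) - 1) / s * Real.log s ^ q) +
    ∫ s in Set.Ioi (Real.exp (-Real.eulerMascheroniConstant)),
      Real.exp (-s) / s * Real.log s ^ q

end

/-! Integration by parts turns the quantile equation into `y^x E(x,y) = p Γ(x+1)`, where `E(x,y) =
e^{-y} + y ∫₀¹ s^x e^{-ys} ds` (`lowerGammaRatio`) is smooth for `x > -1`, in particular across `x =
0` and `y = 0`. Put `L = -log p` and `y = u e^{-L/x}`. Then `y^x = p u^x`, so `p` cancels, and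
taking logarithms and dividing by `x` gives `log u + (1/x) log E(x, u e^{-L/x}) = log Γ(x+1) / x`.
Since `log E(x,y) = y h(x,y)` with `h` smooth near the origin, the singular factor `1/x` occurs only
in `e^{-L/x}/x`, which extends smoothly by `0` to `x ≤ 0`. At `x = 0` the equation reads `log u =
-γ`, with nonzero `u`-derivative, so the implicit function theorem gives a smooth `φ` near `0` that
equals `u_p` to the right of `0` (`exists_contDiffAt_eq_scaledQuantile`).

The flat term does not affect derivatives at `0`, so `u_p'(0) = e^{-γ} (Γ''(1) - γ²)/2`; integrating
by parts in the definition of `s_1` shows that it equals `(Γ''(1) - γ²)/2` (`sConst_one`).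

Finally `m_p = e^{-L/x} u_p`. Leibniz's rule, the polynomials `p_k` and Taylor expansion of the
derivatives of `u_p` give the triple sum (`tripleSum_isBigO`). The two top coefficients come from
the few index triples with maximal `k + l - j`. -/

/-! ### Smoothness of the parametric integral. -/

theorem integrableOn_rpow_mul_log_pow {r : ℝ} (hr : -1 < r) (a : ℕ) :
    MeasureTheory.IntegrableOn (fun s : ℝ => s ^ r * Real.log s ^ a) (Set.Ioc 0 1) := by
  -- The bound `|log s| ≤ s^{-t}/t` costs `s^{-ta}` in all; this `t` keeps `r - ta > -1`.
  set t : ℝ := (r + 1) / (a + 1) with ht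
  have ha : (0 : ℝ) ≤ a := Nat.cast_nonneg a
  have ht0 : 0 < t := div_pos (by linarith) (by linarith)
  have hta : t * a < r + 1 := by
    have : t * (a + 1) = r + 1 := by rw [ht]; field_simp
    linarith
  have hint : MeasureTheory.IntegrableOn (fun s : ℝ => (1 / t) ^ a * s ^ (r - t * a))
      (Set.Ioc 0 1) :=
    ((intervalIntegrable_iff_integrableOn_Ioc_of_le zero_le_one).1
      (intervalIntegral.intervalIntegrable_rpow' (by linarith))).const_mul _
  refine hint.mono' ?_ ?_
  · exact (by fun_prop : Measurable fun s : ℝ => s ^ r * Real.log s ^ a).aestronglyMeasurable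
  · refine (MeasureTheory.ae_restrict_iff' measurableSet_Ioc).2 (.of_forall fun s hs => ?_)
    have h1 : |Real.log s| * s ^ t ≤ 1 / t := by
      have := (Real.abs_log_mul_self_rpow_lt s t hs.1 hs.2 ht0).le
      rwa [abs_mul, abs_of_pos (Real.rpow_pos_of_pos hs.1 t)] at this
    have h2 : (|Real.log s| * s ^ t) ^ a ≤ (1 / t) ^ a :=
      pow_le_pow_left₀ (mul_nonneg (abs_nonneg _) (Real.rpow_nonneg hs.1.le _)) h1 a
    have h3 : s ^ r * |Real.log s| ^ a
        = (|Real.log s| * s ^ t) ^ a * s ^ (r - t * a) := by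
      rw [mul_pow, ← Real.rpow_natCast (s ^ t), ← Real.rpow_mul hs.1.le, mul_assoc,
        ← Real.rpow_add hs.1, mul_comm]
      congr 2
      ring
    rw [norm_mul, norm_pow, Real.norm_eq_abs, Real.norm_eq_abs,
      abs_of_pos (Real.rpow_pos_of_pos hs.1 r), h3]
    exact mul_le_mul_of_nonneg_right h2 (Real.rpow_nonneg hs.1.le _)

/-- The parametric integral `∫₀¹ s^x (log s)^a e^{-ys} ds` as a function of `(x, y)`. -/
noncomputable def powLogExpIntegral (a : ℕ) (q : ℝ × ℝ) : ℝ :=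
  ∫ s in Set.Ioc (0 : ℝ) 1, s ^ q.1 * Real.log s ^ a * Real.exp (-(q.2 * s))

theorem exp_neg_mul_le {y s : ℝ} (hs : s ∈ Set.Ioc (0 : ℝ) 1) :
    Real.exp (-(y * s)) ≤ Real.exp |y| := by
  refine Real.exp_le_exp.2 ?_
  calc -(y * s) ≤ |y * s| := neg_le_abs _
    _ = |y| * s := by rw [abs_mul, abs_of_pos hs.1]
    _ ≤ |y| * 1 := mul_le_mul_of_nonneg_left hs.2 (abs_nonneg _)
    _ = |y| := mul_one _

/-- On `(0,1]` the power `s^x` decreases in `x`, so the smallest exponent dominates uniformly; this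
is the majorant for differentiating under the integral. -/
theorem norm_rpow_mul_log_pow_mul_exp_le {x y r B s : ℝ} (a : ℕ) (hx : r ≤ x) (hy : |y| ≤ B)
    (hs : s ∈ Set.Ioc (0 : ℝ) 1) :
    ‖s ^ x * Real.log s ^ a * Real.exp (-(y * s))‖
      ≤ ‖s ^ r * Real.log s ^ a‖ * Real.exp B := by
  rw [norm_mul, norm_mul, norm_mul, Real.norm_of_nonneg (Real.exp_pos _).le,
    Real.norm_of_nonneg (Real.rpow_nonneg hs.1.le _),
    Real.norm_of_nonneg (Real.rpow_nonneg hs.1.le _)]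
  refine mul_le_mul ?_ ((exp_neg_mul_le hs).trans (Real.exp_le_exp.2 hy)) (Real.exp_pos _).le
    (mul_nonneg (Real.rpow_nonneg hs.1.le _) (norm_nonneg _))
  exact mul_le_mul_of_nonneg_right (Real.rpow_le_rpow_of_exponent_ge hs.1 hs.2 hx) (norm_nonneg _)

theorem integrableOn_rpow_mul_log_pow_mul_exp {x : ℝ} (y : ℝ) (hx : -1 < x) (a : ℕ) :
    MeasureTheory.IntegrableOn
      (fun s : ℝ => s ^ x * Real.log s ^ a * Real.exp (-(y * s))) (Set.Ioc 0 1) := by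
  refine ((integrableOn_rpow_mul_log_pow hx a).norm.mul_const (Real.exp |y|)).mono' ?_ ?_
  · exact (by fun_prop : Measurable fun s : ℝ =>
      s ^ x * Real.log s ^ a * Real.exp (-(y * s))).aestronglyMeasurable
  · exact (MeasureTheory.ae_restrict_iff' measurableSet_Ioc).2
      (.of_forall fun s hs => norm_rpow_mul_log_pow_mul_exp_le a le_rfl le_rfl hs)

theorem hasFDerivAt_powLogExpIntegral (a : ℕ) {q : ℝ × ℝ} (hq : -1 < q.1) :
    HasFDerivAt (powLogExpIntegral a)
      (powLogExpIntegral (a + 1) q • ContinuousLinearMap.fst ℝ ℝ ℝ +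
        (-powLogExpIntegral a (q.1 + 1, q.2)) • ContinuousLinearMap.snd ℝ ℝ ℝ) q := by
  obtain ⟨r, hr1, hr2⟩ := exists_between hq
  set F' : ℝ × ℝ → ℝ → (ℝ × ℝ →L[ℝ] ℝ) := fun z s =>
    (s ^ z.1 * Real.log s ^ (a + 1) * Real.exp (-(z.2 * s))) • ContinuousLinearMap.fst ℝ ℝ ℝ +
      (-(s ^ (z.1 + 1) * Real.log s ^ a * Real.exp (-(z.2 * s)))) •
        ContinuousLinearMap.snd ℝ ℝ ℝ with hF'
  have hi1 := integrableOn_rpow_mul_log_pow_mul_exp q.2 hq (a + 1)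
  have hi2 := integrableOn_rpow_mul_log_pow_mul_exp q.2 (by linarith : -1 < q.1 + 1) a
  have hi3 : MeasureTheory.IntegrableOn (fun s : ℝ =>
      -(s ^ (q.1 + 1) * Real.log s ^ a * Real.exp (-(q.2 * s)))) (Set.Ioc 0 1) := hi2.neg
  have hb1 := (integrableOn_rpow_mul_log_pow hr1 (a + 1)).norm.mul_const (Real.exp (|q.2| + 1))
  have hb2 := (integrableOn_rpow_mul_log_pow (by linarith : -1 < r + 1) a).norm.mul_const
    (Real.exp (|q.2| + 1))
  have hnhds : Set.Ioi r ×ˢ Metric.ball q.2 1 ∈ 𝓝 q :=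
    prod_mem_nhds (Ioi_mem_nhds hr2) (Metric.ball_mem_nhds _ one_pos)
  have hmain := hasFDerivAt_integral_of_dominated_of_fderiv_le
    (μ := MeasureTheory.volume.restrict (Set.Ioc (0 : ℝ) 1)) (F' := F') (𝕜 := ℝ) (x₀ := q) hnhds
    (F := fun z s => s ^ z.1 * Real.log s ^ a * Real.exp (-(z.2 * s)))
    (.of_forall fun z => (by fun_prop : Measurable fun s : ℝ =>
      s ^ z.1 * Real.log s ^ a * Real.exp (-(z.2 * s))).aestronglyMeasurable)
    (integrableOn_rpow_mul_log_pow_mul_exp q.2 hq a)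
    ((hi1.aestronglyMeasurable.smul_const _).add (hi3.aestronglyMeasurable.smul_const _))
    (bound := fun s => ‖s ^ r * Real.log s ^ (a + 1)‖ * Real.exp (|q.2| + 1) +
      ‖s ^ (r + 1) * Real.log s ^ a‖ * Real.exp (|q.2| + 1)) ?_ (hb1.add hb2) ?_
  · have hint : ∫ s in Set.Ioc (0 : ℝ) 1, F' q s =
        powLogExpIntegral (a + 1) q • ContinuousLinearMap.fst ℝ ℝ ℝ +
        (-powLogExpIntegral a (q.1 + 1, q.2)) • ContinuousLinearMap.snd ℝ ℝ ℝ := by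
      simp only [hF']
      rw [MeasureTheory.integral_add (hi1.smul_const _) (hi3.smul_const _),
        integral_smul_const, integral_smul_const, MeasureTheory.integral_neg]
      rfl
    rw [← hint]
    exact hmain
  · refine (MeasureTheory.ae_restrict_iff' measurableSet_Ioc).2 (.of_forall fun s hs z hz => ?_)
    have hz2 : |z.2| ≤ |q.2| + 1 := by
      have h1 : |z.2 - q.2| < 1 := by simpa [Real.dist_eq] using hz.2
      have h2 := abs_sub_abs_le_abs_sub z.2 q.2
      linarith
    have hz1 : r < z.1 := hz.1
    refine (norm_add_le _ _).trans (add_le_add ?_ ?_)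
    · rw [norm_smul]
      calc _ ≤ _ * 1 := mul_le_mul_of_nonneg_left (ContinuousLinearMap.norm_fst_le ..)
            (norm_nonneg _)
        _ ≤ _ := by
          rw [mul_one]
          exact norm_rpow_mul_log_pow_mul_exp_le (a + 1) hz1.le hz2 hs
    · rw [norm_smul, norm_neg]
      calc _ ≤ _ * 1 := mul_le_mul_of_nonneg_left (ContinuousLinearMap.norm_snd_le ..)
            (norm_nonneg _)
        _ ≤ _ := by
          rw [mul_one]
          exact norm_rpow_mul_log_pow_mul_exp_le a (by linarith) hz2 hs
  · refine (MeasureTheory.ae_restrict_iff' measurableSet_Ioc).2 (.of_forall fun s hs z _ => ?_)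
    have h1 : HasFDerivAt (fun z : ℝ × ℝ => z.1) (ContinuousLinearMap.fst ℝ ℝ ℝ) z :=
      hasFDerivAt_fst
    have h2 : HasFDerivAt (fun z : ℝ × ℝ => z.2) (ContinuousLinearMap.snd ℝ ℝ ℝ) z :=
      hasFDerivAt_snd
    have h3 := ((h1.const_rpow hs.1).mul_const (Real.log s ^ a)).mul (h2.mul_const s).neg.exp
    refine h3.congr_fderiv ?_
    ext <;> simp [hF', Real.rpow_add_one hs.1.ne'] <;> ring

/-- The family is closed under differentiation: `∂_x` raises the power of the logarithm, `∂_y`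
shifts `x` by one. Hence the induction runs over all `a` at once. -/
theorem contDiffOn_nat_powLogExpIntegral (n a : ℕ) :
    ContDiffOn ℝ n (powLogExpIntegral a) {q : ℝ × ℝ | -1 < q.1} := by
  have ho : IsOpen {q : ℝ × ℝ | -1 < q.1} := isOpen_lt continuous_const continuous_fst
  induction n generalizing a with
  | zero =>
    rw [Nat.cast_zero, contDiffOn_zero]
    exact fun q hq => (hasFDerivAt_powLogExpIntegral a hq).continuousAt.continuousWithinAt
  | succ n ih =>
    push_cast
    rw [contDiffOn_succ_iff_hasFDerivWithinAt_of_uniqueDiffOn ho.uniqueDiffOn]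
    refine ⟨by simp, _, ?_, fun q hq =>
      (hasFDerivAt_powLogExpIntegral a hq).hasFDerivWithinAt⟩
    have hshift : ContDiffOn ℝ n (fun q : ℝ × ℝ => powLogExpIntegral a (q.1 + 1, q.2))
        {q : ℝ × ℝ | -1 < q.1} := by
      refine (ih a).comp (by fun_prop) fun q hq => ?_
      have : -1 < q.1 := hq
      show -1 < q.1 + 1
      linarith
    exact ((ih (a + 1)).fun_smul contDiffOn_const).add (hshift.neg.fun_smul contDiffOn_const)

theorem contDiffAt_powLogExpIntegral (a : ℕ) {q : ℝ × ℝ} (hq : -1 < q.1) :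
    ContDiffAt ℝ ∞ (powLogExpIntegral a) q :=
  (contDiffOn_infty.2 fun n => contDiffOn_nat_powLogExpIntegral n a).contDiffAt
    ((isOpen_lt continuous_const continuous_fst).mem_nhds hq)

/-! ### A quantile equation that is regular at `x = 0`. -/

/-- The function `e^{-y} + y ∫₀¹ s^x e^{-ys} ds`, which is `x y^{-x} ∫₀^y e^{-t} t^{x-1} dt` for
positive `x` and `y`. -/
noncomputable def lowerGammaRatio (q : ℝ × ℝ) : ℝ := Real.exp (-q.2) + q.2 * powLogExpIntegral 0 q

theorem contDiffAt_lowerGammaRatio {q : ℝ × ℝ} (hq : -1 < q.1) :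
    ContDiffAt ℝ ∞ lowerGammaRatio q :=
  (contDiffAt_snd.neg.exp).add (contDiffAt_snd.mul (contDiffAt_powLogExpIntegral 0 hq))

theorem powLogExpIntegral_zero_nonneg (q : ℝ × ℝ) : 0 ≤ powLogExpIntegral 0 q := by
  refine MeasureTheory.setIntegral_nonneg measurableSet_Ioc fun s hs => ?_
  have := hs.1
  simp only [pow_zero, mul_one]
  positivity

theorem lowerGammaRatio_pos {q : ℝ × ℝ} (hq : 0 ≤ q.2) : 0 < lowerGammaRatio q :=
  add_pos_of_pos_of_nonneg (Real.exp_pos _) (mul_nonneg hq (powLogExpIntegral_zero_nonneg q))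

/-- Integrate the derivative of `e^{-t} t^x` over `[0,y]`, then substitute `t = ys` in the remaining
integral. -/
theorem mul_lowerGamma_eq {x y : ℝ} (hx : 0 < x) (hy : 0 < y) :
    x * lowerGamma x y = y ^ x * lowerGammaRatio (x, y) := by
  have hi1 : IntervalIntegrable (fun t : ℝ => x * (Real.exp (-t) * t ^ (x - 1)))
      MeasureTheory.volume 0 y := (lowerGamma_intervalIntegrable hx le_rfl hy.le).const_mul x
  have hc : Continuous fun t : ℝ => Real.exp (-t) * t ^ x :=
    (by fun_prop : Continuous fun t : ℝ => Real.exp (-t)).mul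
      (Real.continuous_rpow_const hx.le)
  have hi2 := hc.intervalIntegrable (μ := MeasureTheory.volume) 0 y
  have hparts : ∫ t in (0 : ℝ)..y, (x * (Real.exp (-t) * t ^ (x - 1)) - Real.exp (-t) * t ^ x)
      = Real.exp (-y) * y ^ x - Real.exp (-0) * 0 ^ x := by
    refine intervalIntegral.integral_eq_sub_of_hasDerivAt_of_le hy.le hc.continuousOn
      (fun t ht => ?_) (hi1.sub hi2)
    have h := (hasDerivAt_neg t).exp.mul (Real.hasDerivAt_rpow_const (p := x) (Or.inl ht.1.ne'))
    refine h.congr_deriv ?_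
    ring
  rw [intervalIntegral.integral_sub hi1 hi2, intervalIntegral.integral_const_mul,
    Real.zero_rpow hx.ne', mul_zero, sub_zero] at hparts
  have hsubst : ∫ t in (0 : ℝ)..y, Real.exp (-t) * t ^ x
      = y ^ x * (y * powLogExpIntegral 0 (x, y)) := by
    have h := intervalIntegral.integral_comp_mul_left (a := 0) (b := 1)
      (fun t : ℝ => Real.exp (-t) * t ^ x) hy.ne'
    rw [mul_zero, mul_one, smul_eq_mul, eq_inv_mul_iff_mul_eq₀ hy.ne'] at h
    rw [← h, powLogExpIntegral, intervalIntegral.integral_of_le zero_le_one, mul_left_comm,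
      ← MeasureTheory.integral_const_mul (y ^ x)]
    congr 1
    refine MeasureTheory.setIntegral_congr_fun measurableSet_Ioc fun s hs => ?_
    simp only [pow_zero, mul_one]
    rw [Real.mul_rpow hy.le hs.1.le]
    ring
  have : lowerGamma x y = ∫ t in (0 : ℝ)..y, Real.exp (-t) * t ^ (x - 1) := rfl
  rw [lowerGammaRatio, mul_add, ← hsubst, this]
  linarith

theorem hasDerivAt_lowerGamma {x y : ℝ} (hx : 0 < x) (hy : 0 < y) :
    HasDerivAt (lowerGamma x) (Real.exp (-y) * y ^ (x - 1)) y := by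
  refine intervalIntegral.integral_hasDerivAt_right
    (lowerGamma_intervalIntegrable hx le_rfl hy.le) ?_ ?_
  · exact (by fun_prop : Measurable fun t : ℝ =>
      Real.exp (-t) * t ^ (x - 1)).stronglyMeasurable.stronglyMeasurableAtFilter
  · exact (by fun_prop : ContinuousAt (fun t : ℝ => Real.exp (-t)) y).mul
      (Real.continuousAt_rpow_const _ _ (Or.inl hy.ne'))

theorem hasDerivAt_rpow_mul_lowerGammaRatio {x y : ℝ} (hx : 0 < x) (hy : 0 < y) :
    HasDerivAt (fun z => z ^ x * lowerGammaRatio (x, z))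
      (x * (Real.exp (-y) * y ^ (x - 1))) y := by
  refine ((hasDerivAt_lowerGamma hx hy).const_mul x).congr_of_eventuallyEq ?_
  filter_upwards [Ioi_mem_nhds hy] with z hz
  exact (mul_lowerGamma_eq hx hz).symm

/-- The quantile is characterised by `y^x · lowerGammaRatio (x, y) = p Γ(x + 1)`. -/
theorem eq_gammaQuantile {p x y : ℝ} (hp0 : 0 < p) (hp1 : p < 1) (hx : 0 < x) (hy : 0 < y)
    (h : y ^ x * lowerGammaRatio (x, y) = p * Real.Gamma (x + 1)) : y = gammaQuantile p x := by
  refine (existsUnique_lowerGamma_eq hp0 hp1 hx).unique ⟨hy, ?_⟩ (gammaQuantile_spec hp0 hp1 hx)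
  rw [← mul_lowerGamma_eq hx hy, Real.Gamma_add_one hx.ne'] at h
  refine mul_left_cancel₀ hx.ne' ?_
  linarith

theorem gammaQuantile_rpow_mul {p x : ℝ} (hp0 : 0 < p) (hp1 : p < 1) (hx : 0 < x) :
    gammaQuantile p x ^ x * lowerGammaRatio (x, gammaQuantile p x)
      = p * Real.Gamma (x + 1) := by
  obtain ⟨h1, h2⟩ := gammaQuantile_spec hp0 hp1 hx
  rw [← mul_lowerGamma_eq hx h1, h2, Real.Gamma_add_one hx.ne']
  ring

/-! ### Implicit functions and smoothness of the quantile. -/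

/-- A smooth scalar implicit function theorem in the plane. -/
theorem exists_contDiffAt_implicit {Φ : ℝ × ℝ → ℝ} {a b d : ℝ} (h : ContDiffAt ℝ ∞ Φ (a, b))
    (hd : HasDerivAt (fun u => Φ (a, u)) d b) (hd0 : d ≠ 0) :
    ∃ φ : ℝ → ℝ, ContDiffAt ℝ ∞ φ a ∧ φ a = b ∧ ∀ᶠ x in 𝓝 a, Φ (x, φ x) = Φ (a, b) := by
  have hinv : (fderiv ℝ Φ (a, b) ∘L .inr ℝ ℝ ℝ).IsInvertible := by
    have h1 : HasFDerivAt Φ (fderiv ℝ Φ (a, b)) (a, b) :=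
      (h.differentiableAt (by simp)).hasFDerivAt
    have h2 : HasFDerivAt (fun u : ℝ => (a, u)) (ContinuousLinearMap.inr ℝ ℝ ℝ) b :=
      hasFDerivAt_prodMk_right a b
    have h3 := (h1.comp b h2).unique hd.hasFDerivAt
    rw [h3]
    refine ⟨ContinuousLinearEquiv.unitsEquivAut ℝ (Units.mk0 d hd0), ?_⟩
    ext
    simp
  exact ⟨h.implicitFunction (by simp) hinv, h.contDiffAt_implicitFunction (by simp) hinv,
    h.implicitFunction_apply_self (by simp) hinv,
    h.eventually_apply_implicitFunction (by simp) hinv⟩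

theorem analyticAt_Gamma {x : ℝ} (hx : 0 < x) : AnalyticAt ℝ Real.Gamma x := by
  have hopen : IsOpen {z : ℂ | 0 < z.re} := isOpen_lt continuous_const Complex.continuous_re
  have hd : DifferentiableOn ℂ Complex.Gamma {z : ℂ | 0 < z.re} := by
    intro z hz
    refine (Complex.differentiableAt_Gamma z fun m hm => ?_).differentiableWithinAt
    have hz' : 0 < z.re := hz
    rw [hm] at hz'
    simp only [Complex.neg_re, Complex.natCast_re] at hz'
    linarith [(Nat.cast_nonneg m : (0 : ℝ) ≤ m)]
  have ha : AnalyticAt ℂ Complex.Gamma (x : ℂ) :=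
    hd.analyticAt (hopen.mem_nhds (by simpa using hx))
  have h1 : AnalyticAt ℝ (fun t : ℝ => (Complex.Gamma (t : ℂ)).re) x :=
    (Complex.reCLM.analyticAt _).comp
      ((ha.restrictScalars (𝕜 := ℝ)).comp (Complex.ofRealCLM.analyticAt x))
  exact h1

theorem contDiffAt_gammaQuantile {p x : ℝ} (hp0 : 0 < p) (hp1 : p < 1) (hx : 0 < x) :
    ContDiffAt ℝ ∞ (gammaQuantile p) x := by
  set y := gammaQuantile p x with hy
  have hy0 : 0 < y := (gammaQuantile_spec hp0 hp1 hx).1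
  have hΓ : ContDiffAt ℝ ∞ (fun t : ℝ => Real.Gamma (t + 1)) x :=
    ContDiffAt.comp x (g := Real.Gamma) (f := fun t : ℝ => t + 1)
      (analyticAt_Gamma (by linarith : 0 < x + 1)).contDiffAt (contDiffAt_id.add contDiffAt_const)
  have hΦ : ContDiffAt ℝ ∞ (fun q : ℝ × ℝ =>
      q.2 ^ q.1 * lowerGammaRatio q - p * Real.Gamma (q.1 + 1)) (x, y) :=
    ((contDiffAt_snd.rpow contDiffAt_fst hy0.ne').mul
      (contDiffAt_lowerGammaRatio (by simp; linarith))).sub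
      (contDiffAt_const.mul (ContDiffAt.comp (x, y) (g := fun t : ℝ => Real.Gamma (t + 1))
        (f := Prod.fst) hΓ contDiffAt_fst))
  obtain ⟨φ, hφ, hφx, hev⟩ := exists_contDiffAt_implicit hΦ
    ((hasDerivAt_rpow_mul_lowerGammaRatio hx hy0).sub_const (p * Real.Gamma (x + 1)))
    (by positivity)
  -- Near `x` the implicit solution is positive, so uniqueness of the quantile identifies the two.
  refine hφ.congr_of_eventuallyEq ?_
  filter_upwards [hev, Ioi_mem_nhds hx,
    hφ.continuousAt.eventually (lt_mem_nhds (hφx.symm ▸ hy0))] with t ht ht0 htφ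
  refine (eq_gammaQuantile hp0 hp1 ht0 htφ ?_).symm
  have := gammaQuantile_rpow_mul hp0 hp1 hx
  simp only [hy, this, sub_self] at ht
  linarith

/-! ### Removing the division by `x` and by `y`. -/

theorem AnalyticAt.dslope_self {f : ℝ → ℝ} {a : ℝ} (hf : AnalyticAt ℝ f a) :
    AnalyticAt ℝ (dslope f a) a := by
  obtain ⟨q, hq⟩ := hf
  exact hq.has_fpower_series_dslope_fslope.analyticAt

/-- The function `x ↦ log Γ(x + 1) / x`, extended analytically to `0`. -/
noncomputable def logGammaSlope : ℝ → ℝ := dslope (fun x : ℝ => Real.log (Real.Gamma (x + 1))) 0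

/-- The function `z ↦ log (1 + z) / z`, extended analytically to `0`. -/
noncomputable def logSlope : ℝ → ℝ := dslope (fun z : ℝ => Real.log (1 + z)) 0

/-- The function `y ↦ (e^{-y} - 1) / y`, extended analytically to `0`. -/
noncomputable def expNegSlope : ℝ → ℝ := dslope (fun y : ℝ => Real.exp (-y)) 0

theorem mul_logGammaSlope (x : ℝ) : x * logGammaSlope x = Real.log (Real.Gamma (x + 1)) := by
  simpa [logGammaSlope] using sub_smul_dslope (fun x : ℝ => Real.log (Real.Gamma (x + 1))) 0 x

theorem mul_logSlope (z : ℝ) : z * logSlope z = Real.log (1 + z) := by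
  simpa [logSlope] using sub_smul_dslope (fun z : ℝ => Real.log (1 + z)) 0 z

theorem mul_expNegSlope (y : ℝ) : y * expNegSlope y = Real.exp (-y) - 1 := by
  simpa [expNegSlope] using sub_smul_dslope (fun y : ℝ => Real.exp (-y)) 0 y

theorem analyticAt_logSlope : AnalyticAt ℝ logSlope 0 := by
  refine AnalyticAt.dslope_self ?_
  exact (analyticAt_const.add analyticAt_id).log (by simp)

theorem analyticAt_expNegSlope : AnalyticAt ℝ expNegSlope 0 :=
  AnalyticAt.dslope_self analyticAt_id.neg.rexp

theorem analyticAt_logGammaSlope : AnalyticAt ℝ logGammaSlope 0 := by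
  refine AnalyticAt.dslope_self ?_
  have h : AnalyticAt ℝ (fun x : ℝ => Real.Gamma (x + 1)) 0 :=
    AnalyticAt.comp (g := Real.Gamma) (f := fun x : ℝ => x + 1)
      (analyticAt_Gamma (by norm_num)) (analyticAt_id.add analyticAt_const)
  exact h.log (by simp)

theorem hasDerivAt_log_Gamma_add_one {x : ℝ} (hx : -1 < x) :
    HasDerivAt (fun x : ℝ => Real.log (Real.Gamma (x + 1)))
      (deriv Real.Gamma (x + 1) / Real.Gamma (x + 1)) x := by
  have hx1 : 0 < x + 1 := by linarith
  have h : HasDerivAt (fun x : ℝ => Real.Gamma (x + 1)) (deriv Real.Gamma (x + 1)) x :=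
    HasDerivAt.comp_add_const x 1 (analyticAt_Gamma hx1).differentiableAt.hasDerivAt
  exact h.log (Real.Gamma_pos_of_pos hx1).ne'

theorem logGammaSlope_zero : logGammaSlope 0 = -Real.eulerMascheroniConstant := by
  rw [logGammaSlope, dslope_same, (hasDerivAt_log_Gamma_add_one (by norm_num)).deriv, zero_add,
    Real.hasDerivAt_Gamma_one.deriv, Real.Gamma_one, div_one]

/-- Differentiate `x g(x) = log Γ(x+1)` twice at `0`: the left side gives `2g'(0)`, the right side
`(Γ'/Γ)'(1)`, where `Γ'(1) = -γ`. -/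
theorem two_mul_deriv_logGammaSlope_zero :
    2 * deriv logGammaSlope 0
      = deriv (deriv Real.Gamma) 1 - Real.eulerMascheroniConstant ^ 2 := by
  have han := analyticAt_logGammaSlope
  have h1 : deriv (fun x : ℝ => Real.log (Real.Gamma (x + 1))) =ᶠ[𝓝 0]
      fun x => logGammaSlope x + x * deriv logGammaSlope x := by
    filter_upwards [han.eventually_analyticAt] with x hx
    have : (fun x : ℝ => Real.log (Real.Gamma (x + 1))) = fun x => x * logGammaSlope x :=
      funext fun x => (mul_logGammaSlope x).symm
    rw [this]
    simpa using ((hasDerivAt_id x).fun_mul hx.differentiableAt.hasDerivAt).deriv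
  have h2 : HasDerivAt (fun x => logGammaSlope x + x * deriv logGammaSlope x)
      (deriv logGammaSlope 0 + (1 * deriv logGammaSlope 0 + 0 * deriv (deriv logGammaSlope) 0)) 0 :=
    han.differentiableAt.hasDerivAt.add
      ((hasDerivAt_id 0).mul han.deriv.differentiableAt.hasDerivAt)
  have h3 : deriv (fun x : ℝ => Real.log (Real.Gamma (x + 1))) =ᶠ[𝓝 0]
      fun x => deriv Real.Gamma (x + 1) / Real.Gamma (x + 1) := by
    filter_upwards [Ioi_mem_nhds (by norm_num : (-1 : ℝ) < 0)] with x hx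
    exact (hasDerivAt_log_Gamma_add_one hx).deriv
  have hΓ : AnalyticAt ℝ Real.Gamma 1 := analyticAt_Gamma one_pos
  have h4 : HasDerivAt (fun x : ℝ => deriv Real.Gamma (x + 1)) (deriv (deriv Real.Gamma) 1) 0 :=
    HasDerivAt.comp_add_const 0 1 (by simpa using hΓ.deriv.differentiableAt.hasDerivAt)
  have h5 : HasDerivAt (fun x : ℝ => Real.Gamma (x + 1)) (-Real.eulerMascheroniConstant) 0 :=
    HasDerivAt.comp_add_const 0 1 (by simpa using Real.hasDerivAt_Gamma_one)
  have h6 := ((h4.div h5 (by simp)).congr_of_eventuallyEq h3).unique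
    (h2.congr_of_eventuallyEq h1)
  simp only [zero_add, Real.Gamma_one, Real.hasDerivAt_Gamma_one.deriv] at h6
  linarith

/-- The quotient `(lowerGammaRatio (x, y) - 1) / y`, extended smoothly to `y = 0`. -/
noncomputable def lowerGammaRatioSlope (q : ℝ × ℝ) : ℝ := powLogExpIntegral 0 q + expNegSlope q.2

/-- The quotient `log (lowerGammaRatio (x, y)) / y`, extended smoothly to `y = 0`. -/
noncomputable def logLowerGammaRatioSlope (q : ℝ × ℝ) : ℝ :=
  lowerGammaRatioSlope q * logSlope (q.2 * lowerGammaRatioSlope q)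

/-- Extracting the factor `y` is what later absorbs the division by `x`, because `y = u e^{-L/x}`.
-/
theorem mul_logLowerGammaRatioSlope (q : ℝ × ℝ) :
    q.2 * logLowerGammaRatioSlope q = Real.log (lowerGammaRatio q) := by
  have h : lowerGammaRatio q = 1 + q.2 * lowerGammaRatioSlope q := by
    rw [lowerGammaRatio, lowerGammaRatioSlope, mul_add, mul_expNegSlope]
    ring
  rw [h, ← mul_logSlope, logLowerGammaRatioSlope, mul_assoc]

theorem contDiffAt_logLowerGammaRatioSlope : ContDiffAt ℝ ∞ logLowerGammaRatioSlope (0, 0) := by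
  have h1 : ContDiffAt ℝ ∞ lowerGammaRatioSlope (0, 0) :=
    (contDiffAt_powLogExpIntegral 0 (by norm_num)).add
      (ContDiffAt.comp (0, 0) (g := expNegSlope) (f := Prod.snd)
        analyticAt_expNegSlope.contDiffAt contDiffAt_snd)
  refine h1.mul ?_
  refine ContDiffAt.comp (0, 0) (g := logSlope)
    (f := fun q : ℝ × ℝ => q.2 * lowerGammaRatioSlope q) ?_ (contDiffAt_snd.mul h1)
  simpa using analyticAt_logSlope.contDiffAt

/-! ### Flat functions at the origin. -/

/-- The smooth function equal to `e^{-L/x}` for `x > 0` and to `0` for `x ≤ 0`. -/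
noncomputable def expNegDivGlue (L x : ℝ) : ℝ := expNegInvGlue (L⁻¹ * x)

/-- The smooth function equal to `e^{-L/x} / x` for `x > 0` and to `0` for `x ≤ 0`. -/
noncomputable def expNegDivGlueDiv (L x : ℝ) : ℝ :=
  L⁻¹ * ((Polynomial.X : Polynomial ℝ).eval (L⁻¹ * x)⁻¹ * expNegInvGlue (L⁻¹ * x))

theorem contDiff_expNegDivGlue (L : ℝ) : ContDiff ℝ ∞ (expNegDivGlue L) :=
  expNegInvGlue.contDiff.comp (contDiff_const.mul contDiff_id)

theorem contDiff_expNegDivGlueDiv (L : ℝ) : ContDiff ℝ ∞ (expNegDivGlueDiv L) :=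
  contDiff_const.mul ((expNegInvGlue.contDiff_polynomial_eval_inv_mul Polynomial.X).comp
    (contDiff_const.mul contDiff_id))

theorem expNegDivGlue_of_pos {L x : ℝ} (hL : 0 < L) (hx : 0 < x) :
    expNegDivGlue L x = Real.exp (-(L / x)) := by
  have : ¬ L⁻¹ * x ≤ 0 := not_le.2 (by positivity)
  rw [expNegDivGlue, expNegInvGlue, if_neg this, mul_inv, inv_inv, div_eq_mul_inv]

theorem mul_expNegDivGlueDiv {L x : ℝ} (hL : 0 < L) (hx : 0 < x) :
    x * expNegDivGlueDiv L x = expNegDivGlue L x := by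
  rw [expNegDivGlue, expNegDivGlueDiv, Polynomial.eval_X]
  field_simp

theorem expNegDivGlue_zero (L : ℝ) : expNegDivGlue L 0 = 0 := by
  simp [expNegDivGlue, expNegInvGlue.zero]

theorem expNegDivGlueDiv_of_nonpos {L x : ℝ} (hL : 0 < L) (hx : x ≤ 0) :
    expNegDivGlueDiv L x = 0 := by
  rw [expNegDivGlueDiv, expNegInvGlue.zero_of_nonpos (mul_nonpos_of_nonneg_of_nonpos
    (inv_nonneg.2 hL.le) hx), mul_zero, mul_zero]

/-- The function is differentiable and vanishes on `x ≤ 0`, so its derivative is the one-sided one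
from the left. -/
theorem hasDerivAt_expNegDivGlueDiv_zero {L : ℝ} (hL : 0 < L) :
    HasDerivAt (expNegDivGlueDiv L) 0 0 := by
  have h := ((contDiff_expNegDivGlueDiv L).differentiable (by simp) 0).hasDerivAt
  have h0 : HasDerivWithinAt (expNegDivGlueDiv L) 0 (Set.Iic 0) 0 :=
    (hasDerivWithinAt_const (0 : ℝ) (Set.Iic 0) (0 : ℝ)).congr
      (fun x hx => expNegDivGlueDiv_of_nonpos hL hx) (expNegDivGlueDiv_of_nonpos hL le_rfl)
  have := (uniqueDiffWithinAt_Iic (0 : ℝ)).eq_deriv _ h.hasDerivWithinAt h0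
  rwa [this] at h

/-! ### Smooth extension of the scaled quantile to `0`. -/

/-- The scaled quantile agrees to the right of `0` with a function that is smooth at `0`. -/
theorem exists_contDiffAt_eq_scaledQuantile {p : ℝ} (hp0 : 0 < p) (hp1 : p < 1) :
    ∃ φ : ℝ → ℝ, ContDiffAt ℝ ∞ φ 0 ∧ φ 0 = Real.exp (-Real.eulerMascheroniConstant) ∧
      HasDerivAt φ (Real.exp (-Real.eulerMascheroniConstant) * deriv logGammaSlope 0) 0 ∧
      ∀ᶠ x in 𝓝[>] (0 : ℝ), scaledQuantile p x = φ x := by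
  set c := Real.exp (-Real.eulerMascheroniConstant) with hc
  have hc0 : 0 < c := Real.exp_pos _
  set L := -Real.log p with hLdef
  have hL : 0 < L := neg_pos.2 (Real.log_neg hp0 hp1)
  set w : ℝ × ℝ → ℝ := fun q =>
    q.2 * logLowerGammaRatioSlope (q.1, q.2 * expNegDivGlue L q.1) with hw
  have hwc : ContDiffAt ℝ ∞ w (0, c) := by
    refine contDiffAt_snd.mul (ContDiffAt.comp (0, c) (g := logLowerGammaRatioSlope)
      (f := fun q : ℝ × ℝ => (q.1, q.2 * expNegDivGlue L q.1)) ?_ ?_)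
    · simpa [expNegDivGlue_zero] using contDiffAt_logLowerGammaRatioSlope
    · exact contDiffAt_fst.prodMk
        (contDiffAt_snd.mul ((contDiff_expNegDivGlue L).comp contDiff_fst).contDiffAt)
  -- For `x > 0`, `Φ(x,u) = 0` is the logarithm of the quantile equation divided by `x`; for `x ≤ 0`
  -- the middle term vanishes.
  set Φ : ℝ × ℝ → ℝ := fun q =>
    Real.log q.2 + expNegDivGlueDiv L q.1 * w q - logGammaSlope q.1 with hΦ
  have hΦc : ContDiffAt ℝ ∞ Φ (0, c) := by
    refine ((contDiffAt_snd.log hc0.ne').add ?_).sub (ContDiffAt.comp (0, c)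
      (g := logGammaSlope) (f := Prod.fst) analyticAt_logGammaSlope.contDiffAt contDiffAt_fst)
    exact ((contDiff_expNegDivGlueDiv L).comp contDiff_fst).contDiffAt.mul hwc
  have hΦ0 : ∀ u, Φ (0, u) = Real.log u - logGammaSlope 0 := fun u => by
    simp [hΦ, expNegDivGlueDiv_of_nonpos hL le_rfl]
  have hder : HasDerivAt (fun u => Φ (0, u)) c⁻¹ c := by
    simp only [hΦ0]
    exact (Real.hasDerivAt_log hc0.ne').sub_const _
  obtain ⟨φ, hφ, hφ0, hev⟩ := exists_contDiffAt_implicit hΦc hder (inv_pos.2 hc0).ne'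
  have hval : Φ (0, c) = 0 := by
    rw [hΦ0, logGammaSlope_zero, hc, Real.log_exp, sub_self]
  rw [hval] at hev
  have hpos : ∀ᶠ x in 𝓝 (0 : ℝ), 0 < φ x :=
    hφ.continuousAt.eventually (lt_mem_nhds (hφ0.symm ▸ hc0))
  refine ⟨φ, hφ, hφ0, ?_, ?_⟩
  · have hw0 : DifferentiableAt ℝ (fun x => w (x, φ x)) 0 := by
      refine DifferentiableAt.comp (0 : ℝ) (g := w) (f := fun x => (x, φ x)) ?_ ?_
      · rw [hφ0]
        exact hwc.differentiableAt (by simp)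
      · exact differentiableAt_id.prodMk (hφ.differentiableAt (by simp))
    -- Near `0`, `φ` is the exponential of this difference. The flat factor and its derivative
    -- vanish at `0`, so only the slope of `log Γ(x+1)/x` survives.
    have h1 := analyticAt_logGammaSlope.differentiableAt.hasDerivAt.sub
      ((hasDerivAt_expNegDivGlueDiv_zero hL).mul hw0.hasDerivAt)
    have h2 := h1.exp
    rw [expNegDivGlueDiv_of_nonpos hL le_rfl] at h2
    have h3 : φ =ᶠ[𝓝 0] fun x => Real.exp (logGammaSlope x - expNegDivGlueDiv L x * w (x, φ x)) := by
      filter_upwards [hev, hpos] with x hx hx0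
      have hx' : Real.log (φ x) + expNegDivGlueDiv L x * w (x, φ x) - logGammaSlope x = 0 := hx
      rw [show logGammaSlope x - expNegDivGlueDiv L x * w (x, φ x) = Real.log (φ x) by linarith,
        Real.exp_log hx0]
    refine (h2.congr_of_eventuallyEq h3).congr_deriv ?_
    simp [logGammaSlope_zero, expNegDivGlueDiv_of_nonpos hL le_rfl, hc]
  · filter_upwards [nhdsWithin_le_nhds hev, nhdsWithin_le_nhds hpos, self_mem_nhdsWithin]
      with x hx hu hx0
    have hx0 : 0 < x := hx0
    have hg : 0 < expNegDivGlue L x := by rw [expNegDivGlue_of_pos hL hx0]; exact Real.exp_pos _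
    have hy : 0 < φ x * expNegDivGlue L x := mul_pos hu hg
    have hE : 0 < lowerGammaRatio (x, φ x * expNegDivGlue L x) := lowerGammaRatio_pos hy.le
    have hlog : x * Real.log (φ x) + Real.log (lowerGammaRatio (x, φ x * expNegDivGlue L x))
        = Real.log (Real.Gamma (x + 1)) := by
      rw [← mul_logGammaSlope, ← mul_logLowerGammaRatioSlope]
      simp only [hΦ, hw] at hx
      rw [← sub_eq_zero, ← mul_zero x, ← hx]
      simp only [← mul_expNegDivGlueDiv hL hx0]
      ring
    have hprod : φ x ^ x * lowerGammaRatio (x, φ x * expNegDivGlue L x)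
        = Real.Gamma (x + 1) := by
      rw [Real.rpow_def_of_pos hu, ← Real.exp_log (Real.Gamma_pos_of_pos (by linarith : 0 < x + 1)),
        ← hlog, Real.exp_add, Real.exp_log hE, mul_comm x]
    have hpow : expNegDivGlue L x ^ x = p := by
      rw [expNegDivGlue_of_pos hL hx0, ← Real.exp_mul, neg_mul, div_mul_cancel₀ _ hx0.ne', hLdef,
        neg_neg, Real.exp_log hp0]
    have hm : φ x * expNegDivGlue L x = gammaQuantile p x := by
      refine eq_gammaQuantile hp0 hp1 hx0 hy ?_
      rw [Real.mul_rpow hu.le hg.le, hpow, ← hprod]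
      ring
    rw [scaledQuantile, ← hm, expNegDivGlue_of_pos hL hx0, hLdef, mul_left_comm, ← Real.exp_add]
    simp [neg_div]

/-! ### Evaluation of `s_1`. -/

/-- `Γ` is the Mellin transform of `e^{-t}`, and each differentiation multiplies the integrand by
`log t`. -/
theorem integrableOn_log_sq_mul_exp_neg_and_deriv_deriv_Gamma_one :
    MeasureTheory.IntegrableOn (fun s : ℝ => Real.log s ^ 2 * Real.exp (-s)) (Set.Ioi 0) ∧
      deriv (deriv Real.Gamma) 1 = ∫ s in Set.Ioi (0 : ℝ), Real.log s ^ 2 * Real.exp (-s) := by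
  set f : ℝ → ℂ := fun t => ((Real.exp (-t) : ℝ) : ℂ) with hf
  set g : ℝ → ℂ := fun t => Real.log t • f t with hg
  have hfc : Continuous f := Complex.continuous_ofReal.comp (Real.continuous_exp.comp continuous_neg)
  have hfl : MeasureTheory.LocallyIntegrableOn f (Set.Ioi 0) :=
    hfc.continuousOn.locallyIntegrableOn measurableSet_Ioi
  have hgl : MeasureTheory.LocallyIntegrableOn g (Set.Ioi 0) := by
    refine ContinuousOn.locallyIntegrableOn ?_ measurableSet_Ioi
    exact (Real.continuousOn_log.mono fun t ht => (ne_of_gt ht : t ≠ 0)).smul hfc.continuousOn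
  have hft : ∀ a : ℝ, f =O[Filter.atTop] fun t => t ^ (-a) := fun a => by
    rw [← Asymptotics.isBigO_norm_left]
    simp_rw [hf, Complex.norm_real, Asymptotics.isBigO_norm_left]
    simpa only [neg_one_mul] using (isLittleO_exp_neg_mul_rpow_atTop zero_lt_one (-a)).isBigO
  have hf0 : f =O[𝓝[>] 0] fun t : ℝ => t ^ (-0 : ℝ) := by
    simp_rw [neg_zero, Real.rpow_zero]
    exact Asymptotics.isBigO_const_of_tendsto hfc.continuousWithinAt (by simp)
  have hG1 : ∀ s : ℂ, 0 < s.re → HasDerivAt Complex.Gamma (mellin g s) s := fun s hs => by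
    refine (mellin_hasDerivAt_of_isBigO_rpow hfl (hft (s.re + 1)) (lt_add_one _) hf0
      hs).2.congr_of_eventuallyEq ?_
    filter_upwards [(isOpen_lt continuous_const Complex.continuous_re).mem_nhds hs] with z hz
    rw [Complex.Gamma_eq_integral hz, Complex.GammaIntegral_eq_mellin]
  -- The logarithm costs a little in each decay exponent; any choice with `1/2 < 1 < 2 < 3` leaves
  -- room around `s = 1`.
  obtain ⟨hconv, hG2⟩ := mellin_hasDerivAt_of_isBigO_rpow (s := ((1 : ℝ) : ℂ)) hgl
    (isBigO_rpow_top_log_smul (a := 3) (b := 2) (by norm_num) (hft 3)) (by norm_num)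
    (isBigO_rpow_zero_log_smul (a := 0) (b := 1 / 2) (by norm_num) hf0) (by norm_num)
  have hd1 : deriv Real.Gamma =ᶠ[𝓝 1] fun x : ℝ => (mellin g (x : ℂ)).re := by
    filter_upwards [Ioi_mem_nhds one_pos] with x hx
    exact ((hG1 x (by simpa using hx)).real_of_complex).deriv
  have hfun : Set.EqOn (fun t : ℝ => (t : ℂ) ^ (((1 : ℝ) : ℂ) - 1) • Real.log t • g t)
      (fun t : ℝ => ((Real.log t ^ 2 * Real.exp (-t) : ℝ) : ℂ)) (Set.Ioi 0) := fun t _ => by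
    simp only [hg, hf, Complex.ofReal_one, sub_self, Complex.cpow_zero, one_smul,
      Complex.real_smul]
    push_cast
    ring
  constructor
  · have h := ((MeasureTheory.integrableOn_congr_fun hfun measurableSet_Ioi).1 hconv).re
    exact h
  · rw [hd1.deriv_eq, hG2.real_of_complex.deriv, mellin,
      MeasureTheory.setIntegral_congr_fun measurableSet_Ioi hfun, integral_complex_ofReal,
      Complex.ofReal_re]

theorem hasDerivAt_half_log_sq {s : ℝ} (hs : 0 < s) :
    HasDerivAt (fun s : ℝ => 1 / 2 * Real.log s ^ 2) (Real.log s / s) s := by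
  refine (((Real.hasDerivAt_log hs.ne').pow 2).const_mul (1 / 2)).congr_deriv ?_
  field_simp
  norm_num

/-- Integration by parts with `log s / s = (½ log² s)'`; the boundary term at infinity vanishes. -/
theorem integral_exp_neg_div_mul_log {c : ℝ} (hc : 0 < c) :
    ∫ s in Set.Ioi c, Real.exp (-s) / s * Real.log s
      = -(1 / 2 * Real.log c ^ 2 * Real.exp (-c)) +
        1 / 2 * ∫ s in Set.Ioi c, Real.log s ^ 2 * Real.exp (-s) := by
  have hI : MeasureTheory.IntegrableOn (fun s : ℝ => Real.log s ^ 2 * Real.exp (-s))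
      (Set.Ioi c) :=
    integrableOn_log_sq_mul_exp_neg_and_deriv_deriv_Gamma_one.1.mono_set
      (Set.Ioi_subset_Ioi hc.le)
  have hI' : MeasureTheory.IntegrableOn (fun s : ℝ => Real.exp (-s) / s * Real.log s)
      (Set.Ioi c) := by
    have hexp : MeasureTheory.IntegrableOn (fun s : ℝ => Real.exp (-s)) (Set.Ioi c) :=
      integrableOn_exp_neg_Ioi c
    refine ((hexp.add hI).const_mul c⁻¹).mono' ?_ ?_
    · exact (by fun_prop : Measurable fun s : ℝ =>
        Real.exp (-s) / s * Real.log s).aestronglyMeasurable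
    · refine (MeasureTheory.ae_restrict_iff' measurableSet_Ioi).2 (.of_forall fun s hs => ?_)
      have hs0 : 0 < s := hc.trans hs
      have h1 : s⁻¹ ≤ c⁻¹ := inv_anti₀ hc (le_of_lt hs)
      have h2 : |Real.log s| ≤ 1 + Real.log s ^ 2 := by
        rw [← sq_abs]
        nlinarith [sq_nonneg (|Real.log s| - 1), abs_nonneg (Real.log s)]
      rw [norm_mul, norm_div, Real.norm_eq_abs, Real.norm_eq_abs, Real.norm_eq_abs, Real.abs_exp,
        abs_of_pos hs0]
      calc Real.exp (-s) / s * |Real.log s|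
          = s⁻¹ * (Real.exp (-s) * |Real.log s|) := by ring
        _ ≤ c⁻¹ * (Real.exp (-s) * (1 + Real.log s ^ 2)) := by gcongr
        _ = _ := by simp only [Pi.add_apply]; ring
  have hlim : Filter.Tendsto (fun s : ℝ => 1 / 2 * Real.log s ^ 2 * Real.exp (-s))
      Filter.atTop (𝓝 0) := by
    refine squeeze_zero' (.of_forall fun s => by positivity) ?_
      (Real.tendsto_pow_mul_exp_neg_atTop_nhds_zero 2)
    filter_upwards [Filter.eventually_ge_atTop 1] with s hs
    have h1 : 0 ≤ Real.log s := Real.log_nonneg hs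
    have h2 : Real.log s ≤ s := Real.log_le_self (by linarith)
    refine mul_le_mul_of_nonneg_right ?_ (Real.exp_pos _).le
    nlinarith
  have h := MeasureTheory.integral_Ioi_of_hasDerivAt_of_tendsto'
    (f := fun s : ℝ => 1 / 2 * Real.log s ^ 2 * Real.exp (-s))
    (f' := fun s : ℝ => Real.exp (-s) / s * Real.log s -
      1 / 2 * (Real.log s ^ 2 * Real.exp (-s))) (a := c) (fun s hs => ?_)
    (hI'.sub (hI.const_mul _)) hlim
  · rw [MeasureTheory.integral_sub hI' (hI.const_mul _), MeasureTheory.integral_const_mul] at h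
    linarith
  · refine ((hasDerivAt_half_log_sq (hc.trans_le hs)).mul (hasDerivAt_neg s).exp).congr_deriv ?_
    ring

/-- The same integration by parts; subtracting `1` from `e^{-s}` makes the boundary term at `0`
vanish, as it is bounded by `s log² s`. -/
theorem integral_exp_neg_sub_one_div_mul_log {c : ℝ} (hc : 0 < c) :
    ∫ s in (0 : ℝ)..c, (Real.exp (-s) - 1) / s * Real.log s
      = 1 / 2 * Real.log c ^ 2 * (Real.exp (-c) - 1) +
        1 / 2 * ∫ s in (0 : ℝ)..c, Real.log s ^ 2 * Real.exp (-s) := by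
  have hI : IntervalIntegrable (fun s : ℝ => Real.log s ^ 2 * Real.exp (-s))
      MeasureTheory.volume 0 c :=
    (intervalIntegrable_iff_integrableOn_Ioc_of_le hc.le).2
      (integrableOn_log_sq_mul_exp_neg_and_deriv_deriv_Gamma_one.1.mono_set fun s hs => hs.1)
  have hle : ∀ s : ℝ, 0 < s → |Real.exp (-s) - 1| ≤ s := fun s hs => by
    rw [abs_sub_comm, abs_of_nonneg (by simp [hs.le])]
    linarith [Real.one_sub_le_exp_neg s]
  have hI' : IntervalIntegrable (fun s : ℝ => (Real.exp (-s) - 1) / s * Real.log s)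
      MeasureTheory.volume 0 c := by
    refine (intervalIntegral.intervalIntegrable_log' (a := 0) (b := c)).norm.mono_fun' ?_ ?_
    · exact (by fun_prop : Measurable fun s : ℝ =>
        (Real.exp (-s) - 1) / s * Real.log s).aestronglyMeasurable
    · refine (MeasureTheory.ae_restrict_iff' measurableSet_uIoc).2 (.of_forall fun s hs => ?_)
      rw [Set.uIoc_of_le hc.le] at hs
      beta_reduce
      rw [norm_mul, norm_div, Real.norm_of_nonneg hs.1.le]
      exact mul_le_of_le_one_left (norm_nonneg _) ((div_le_one hs.1).2 (hle s hs.1))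
  have hlim0 : Filter.Tendsto (fun s : ℝ => 1 / 2 * Real.log s ^ 2 * (Real.exp (-s) - 1))
      (𝓝[>] 0) (𝓝 0) := by
    have h0 := ((tendsto_log_mul_rpow_nhdsGT_zero (r := 1 / 2) (by norm_num)).pow 2)
    rw [zero_pow two_ne_zero] at h0
    refine squeeze_zero_norm' ?_ h0
    filter_upwards [self_mem_nhdsWithin] with s hs
    have hs : 0 < s := hs
    have hsq : (s ^ (1 / 2 : ℝ)) ^ 2 = s := by
      rw [← Real.sqrt_eq_rpow, Real.sq_sqrt hs.le]
    rw [mul_pow, hsq, norm_mul, Real.norm_eq_abs (_ - 1), Real.norm_of_nonneg (by positivity)]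
    refine mul_le_mul ?_ (hle s hs) (abs_nonneg _) (sq_nonneg _)
    nlinarith [sq_nonneg (Real.log s)]
  have hder : ∀ s : ℝ, 0 < s →
      HasDerivAt (fun s : ℝ => 1 / 2 * Real.log s ^ 2 * (Real.exp (-s) - 1))
      ((Real.exp (-s) - 1) / s * Real.log s - 1 / 2 * (Real.log s ^ 2 * Real.exp (-s))) s :=
    fun s hs => by
      refine ((hasDerivAt_half_log_sq hs).mul ((hasDerivAt_neg s).exp.sub_const 1)).congr_deriv ?_
      ring
  have h := intervalIntegral.integral_eq_sub_of_hasDerivAt_of_tendsto hc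
    (fun s hs => hder s hs.1) (hI'.sub (hI.const_mul _)) hlim0
    ((hder c hc).continuousAt.tendsto.mono_left nhdsWithin_le_nhds)
  rw [intervalIntegral.integral_sub hI' (hI.const_mul _), intervalIntegral.integral_const_mul] at h
  linarith

/-- At `c = e^{-γ}` the two boundary terms at `c` add up to `-γ²/2`, and the two integrals of `log²
s · e^{-s}` join to give `Γ''(1)/2`. -/
theorem sConst_one : sConst 1 = deriv logGammaSlope 0 := by
  obtain ⟨hI, hΓ⟩ := integrableOn_log_sq_mul_exp_neg_and_deriv_deriv_Gamma_one
  have hc : 0 < Real.exp (-Real.eulerMascheroniConstant) := Real.exp_pos _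
  have h := two_mul_deriv_logGammaSlope_zero
  rw [hΓ, ← intervalIntegral.integral_interval_add_Ioi hI
    (hI.mono_set (Set.Ioi_subset_Ioi hc.le))] at h
  simp only [sConst, pow_one]
  rw [integral_exp_neg_sub_one_div_mul_log hc, integral_exp_neg_div_mul_log hc, Real.log_exp]
  linarith

/-! ### Coefficients of the polynomials `p_k` and derivatives of `e^{-L/x}`. -/

theorem expInvPoly_coeff_succ (k i : ℕ) :
    (expInvPoly (k + 1)).coeff (i + 2)
      = (expInvPoly k).coeff i - (expInvPoly k).coeff (i + 1) * (i + 1) := by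
  rw [expInvPoly, mul_comm, Polynomial.coeff_mul_X_pow, Polynomial.coeff_sub,
    Polynomial.coeff_derivative]

theorem expInvPoly_natDegree_le (k : ℕ) : (expInvPoly k).natDegree ≤ 2 * k := by
  induction k with
  | zero => simp [expInvPoly]
  | succ k ih =>
    refine Polynomial.natDegree_mul_le.trans ?_
    have h1 : (expInvPoly k - Polynomial.derivative (expInvPoly k)).natDegree ≤ 2 * k :=
      (Polynomial.natDegree_sub_le _ _).trans
        (max_le ih ((Polynomial.natDegree_derivative_le _).trans (by omega)))
    rw [Polynomial.natDegree_X_pow]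
    omega

theorem expInvPoly_coeff_of_lt {k i : ℕ} (h : i < k) : (expInvPoly k).coeff i = 0 := by
  induction k generalizing i with
  | zero => omega
  | succ k ih =>
    rcases lt_or_ge i 2 with hi | hi
    · rw [expInvPoly, mul_comm, Polynomial.coeff_mul_X_pow', if_neg (by omega)]
    · obtain ⟨j, rfl⟩ := Nat.exists_eq_add_of_le' hi
      rw [expInvPoly_coeff_succ, ih (by omega), ih (by omega), zero_mul, sub_zero]

theorem expInvPoly_coeff_two_mul (k : ℕ) : (expInvPoly k).coeff (2 * k) = 1 := by
  induction k with
  | zero => simp [expInvPoly]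
  | succ k ih =>
    rw [mul_add, mul_one, expInvPoly_coeff_succ, ih, Polynomial.coeff_eq_zero_of_natDegree_lt
      (lt_of_le_of_lt (expInvPoly_natDegree_le k) (Nat.lt_succ_self _)), zero_mul, sub_zero]

theorem expInvPoly_coeff_two_mul_add_one (k : ℕ) :
    (expInvPoly (k + 1)).coeff (2 * k + 1) = -((k + 1 : ℤ) * k) := by
  induction k with
  | zero => simp [expInvPoly, Polynomial.coeff_X_pow]
  | succ k ih =>
    rw [show 2 * (k + 1) + 1 = (2 * k + 1) + 2 by ring, expInvPoly_coeff_succ, ih,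
      show 2 * k + 1 + 1 = 2 * (k + 1) by ring, expInvPoly_coeff_two_mul]
    push_cast
    ring

theorem iteratedDeriv_exp_neg_div (k : ℕ) {L x : ℝ} (hL : L ≠ 0) (hx : x ≠ 0) :
    iteratedDeriv k (fun y : ℝ => Real.exp (-(L / y))) x
      = (L ^ k)⁻¹ * Polynomial.aeval (L / x) (expInvPoly k) * Real.exp (-(L / x)) := by
  induction k generalizing x with
  | zero => simp [expInvPoly]
  | succ k ih =>
    have hev : iteratedDeriv k (fun y : ℝ => Real.exp (-(L / y))) =ᶠ[𝓝 x]
        fun y => (L ^ k)⁻¹ * (Polynomial.aeval (L * y⁻¹) (expInvPoly k) * Real.exp (-(L * y⁻¹))) := by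
      filter_upwards [isOpen_ne.mem_nhds hx] with y hy
      rw [ih hy, div_eq_mul_inv, mul_assoc]
    rw [iteratedDeriv_succ, hev.deriv_eq]
    have h1 : HasDerivAt (fun y : ℝ => L * y⁻¹) (L * -(x ^ 2)⁻¹) x := (hasDerivAt_inv hx).const_mul L
    have h2 := ((expInvPoly k).hasDerivAt_aeval (L * x⁻¹)).comp x h1
    have h4 := ((h2.mul h1.neg.exp).const_mul (L ^ k)⁻¹).deriv
    refine Eq.trans h4 ?_
    simp only [expInvPoly, map_mul, map_sub, map_pow, Polynomial.aeval_X, div_eq_mul_inv,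
      Function.comp, Pi.neg_apply]
    field_simp
    ring

/-- Only the powers `t^k, …, t^{2k}` occur in `p_k`, so the prefactor `L^{-k}` cancels and leaves
`L^l`. -/
theorem inv_pow_mul_aeval_expInvPoly (k : ℕ) {L x : ℝ} (hL : L ≠ 0) :
    (L ^ k)⁻¹ * Polynomial.aeval (L / x) (expInvPoly k)
      = ∑ l ∈ Finset.range (k + 1), expInvCoeff (l + k) k * L ^ l / x ^ (k + l) := by
  rw [Polynomial.aeval_eq_sum_range' (n := k + (k + 1))
    (lt_of_le_of_lt (expInvPoly_natDegree_le k) (by omega)), Finset.sum_range_add,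
    Finset.sum_eq_zero, zero_add, Finset.mul_sum]
  · refine Finset.sum_congr rfl fun l _ => ?_
    rw [zsmul_eq_mul, expInvCoeff, add_comm l k, div_pow, pow_add L]
    field_simp
  · intro i hi
    rw [expInvPoly_coeff_of_lt (Finset.mem_range.1 hi), zero_smul]

/-! ### Taylor expansion and the triple sum. -/

theorem ContDiffAt.iteratedDeriv_infty {f : ℝ → ℝ} {a : ℝ} (hf : ContDiffAt ℝ ∞ f a) (j : ℕ) :
    ContDiffAt ℝ ∞ (iteratedDeriv j f) a := by
  induction j with
  | zero => simpa using hf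
  | succ j ih =>
    rw [iteratedDeriv_succ]
    exact (ih.fderiv_right (m := ∞) (by simp)).clm_apply contDiffAt_const

theorem ContDiffAt.taylor_isBigO {f : ℝ → ℝ} (hf : ContDiffAt ℝ ∞ f 0) (N : ℕ) :
    (fun x => f x - ∑ j ∈ Finset.range (N + 1), iteratedDeriv j f 0 / j.factorial * x ^ j)
      =O[𝓝 0] fun x => x ^ (N + 1) := by
  -- Expanding one order further, with a little-o error, and moving the extra term into the error
  -- yields the big-O bound.
  have hN : ContDiffAt ℝ ((N + 1 : ℕ) : ℕ∞) f 0 := hf.of_le (by exact_mod_cast le_top)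
  obtain ⟨u, hu, hfu⟩ := hN.contDiffOn le_rfl (by simp)
  obtain ⟨ε, hε, hball⟩ := Metric.mem_nhds_iff.1 (by simpa using hu)
  have h0 : (0 : ℝ) ∈ Metric.ball (0 : ℝ) ε := Metric.mem_ball_self hε
  have h := taylor_isLittleO (convex_ball (0 : ℝ) ε) h0 (hfu.mono hball)
  rw [Metric.isOpen_ball.nhdsWithin_eq h0] at h
  simp only [sub_zero] at h
  have hlast : (fun x : ℝ => iteratedDeriv (N + 1) f 0 / (N + 1).factorial * x ^ (N + 1))
      =O[𝓝 0] fun x : ℝ => x ^ (N + 1) := Asymptotics.isBigO_const_mul_self _ _ _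
  refine (h.isBigO.add hlast).congr_left fun x => ?_
  rw [taylor_within_apply, Finset.sum_range_succ]
  simp only [sub_zero, smul_eq_mul, iteratedDerivWithin_of_isOpen Metric.isOpen_ball h0]
  rw [show ∑ j ∈ Finset.range (N + 1), ((j.factorial : ℝ)⁻¹ * x ^ j) * iteratedDeriv j f 0
    = ∑ j ∈ Finset.range (N + 1), iteratedDeriv j f 0 / j.factorial * x ^ j from
      Finset.sum_congr rfl fun j _ => by ring]
  ring

theorem Filter.EventuallyEq.iteratedDeriv_nhdsGT {f g : ℝ → ℝ} {a : ℝ} (h : f =ᶠ[𝓝[>] a] g)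
    (j : ℕ) : iteratedDeriv j f =ᶠ[𝓝[>] a] iteratedDeriv j g := by
  filter_upwards [eventually_eventually_nhdsWithin.2 h, self_mem_nhdsWithin] with x hx hxa
  rw [isOpen_Ioi.nhdsWithin_eq hxa] at hx
  exact Filter.EventuallyEq.iteratedDeriv_eq j hx

theorem contDiffAt_exp_neg_div (L : ℝ) {x : ℝ} (hx : x ≠ 0) :
    ContDiffAt ℝ ∞ (fun y : ℝ => Real.exp (-(L / y))) x :=
  (contDiffAt_const.div contDiffAt_id hx).neg.exp

theorem exp_mul_iteratedDeriv_gammaQuantile {p x : ℝ} (hp0 : 0 < p) (hp1 : p < 1) (hx : 0 < x)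
    (n : ℕ) :
    Real.exp (-(Real.log p / x)) * iteratedDeriv n (gammaQuantile p) x
      = ∑ k ∈ Finset.range (n + 1), ∑ l ∈ Finset.range (k + 1),
          (n.choose k : ℝ) * expInvCoeff (l + k) k * (-Real.log p) ^ l / x ^ (k + l) *
            iteratedDeriv (n - k) (scaledQuantile p) x := by
  have hL : -Real.log p ≠ 0 := (neg_pos.2 (Real.log_neg hp0 hp1)).ne'
  have hsmooth : ContDiffAt ℝ ∞ (scaledQuantile p) x :=
    (contDiffAt_exp_neg_div _ hx.ne').mul (contDiffAt_gammaQuantile hp0 hp1 hx)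
  have hfun : gammaQuantile p
      = fun y => Real.exp (-(-Real.log p / y)) * scaledQuantile p y := by
    funext y
    rw [scaledQuantile, ← mul_assoc, ← Real.exp_add]
    simp [neg_div]
  have hn : ((n : ℕ) : WithTop ℕ∞) ≤ ∞ := by exact_mod_cast le_top
  rw [hfun, iteratedDeriv_fun_mul ((contDiffAt_exp_neg_div _ hx.ne').of_le hn)
    (hsmooth.of_le hn), Finset.mul_sum]
  refine Finset.sum_congr rfl fun k _ => ?_
  have hexp : Real.exp (-(Real.log p / x)) * Real.exp (-(-Real.log p / x)) = 1 := by
    rw [← Real.exp_add]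
    simp [neg_div]
  rw [iteratedDeriv_exp_neg_div k hL hx.ne', inv_pow_mul_aeval_expInvPoly k hL,
    show ∀ A B C D E : ℝ, A * (B * (C * D) * E) = (A * D) * (B * C * E) by intros; ring, hexp,
    one_mul, Finset.mul_sum, Finset.sum_mul]
  refine Finset.sum_congr rfl fun l _ => ?_
  ring

theorem expansionTerm_div_zpow (p : ℝ) (n k l j : ℕ) {x : ℝ} (hx : x ≠ 0) :
    expansionTerm p n k l j / x ^ ((k : ℤ) + (l : ℤ) - (j : ℤ))
      = (n.choose k : ℝ) * expInvCoeff (l + k) k * (-Real.log p) ^ l / x ^ (k + l) *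
          (scaledQuantileDerivZero p (n - k + j) / j.factorial * x ^ j) := by
  have h : x ^ ((k : ℤ) + (l : ℤ) - (j : ℤ)) = x ^ (k + l) / x ^ j := by
    rw [zpow_sub₀ hx, ← Nat.cast_add, zpow_natCast, zpow_natCast]
  rw [h, expansionTerm]
  field_simp

theorem isBigO_pow_self_nhdsGT {m : ℕ} (hm : 1 ≤ m) :
    (fun x : ℝ => x ^ m) =O[𝓝[>] (0 : ℝ)] fun x : ℝ => x := by
  refine Asymptotics.IsBigO.of_bound 1 ?_
  filter_upwards [Ioo_mem_nhdsGT one_pos] with x hx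
  rw [one_mul, norm_pow, Real.norm_of_nonneg hx.1.le]
  exact pow_le_of_le_one hx.1.le hx.2.le (by omega)

theorem tendsto_iteratedDeriv_scaledQuantile {p : ℝ} {φ : ℝ → ℝ} (hφ : ContDiffAt ℝ ∞ φ 0)
    (hev : scaledQuantile p =ᶠ[𝓝[>] (0 : ℝ)] φ) (j : ℕ) :
    Filter.Tendsto (iteratedDeriv j (scaledQuantile p)) (𝓝[>] (0 : ℝ))
      (𝓝 (iteratedDeriv j φ 0)) :=
  ((hφ.iteratedDeriv_infty j).continuousAt.tendsto.mono_left nhdsWithin_le_nhds).congr'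
    (hev.iteratedDeriv_nhdsGT j).symm

theorem scaledQuantileDerivZero_eq {p : ℝ} {φ : ℝ → ℝ} (hφ : ContDiffAt ℝ ∞ φ 0)
    (hev : scaledQuantile p =ᶠ[𝓝[>] (0 : ℝ)] φ) (j : ℕ) :
    scaledQuantileDerivZero p j = iteratedDeriv j φ 0 :=
  (tendsto_iteratedDeriv_scaledQuantile hφ hev j).limUnder_eq

theorem iteratedDeriv_scaledQuantile_taylor {p : ℝ} {φ : ℝ → ℝ} (hφ : ContDiffAt ℝ ∞ φ 0)
    (hev : scaledQuantile p =ᶠ[𝓝[>] (0 : ℝ)] φ) (i N : ℕ) :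
    (fun x => iteratedDeriv i (scaledQuantile p) x -
      ∑ j ∈ Finset.range (N + 1), scaledQuantileDerivZero p (i + j) / j.factorial * x ^ j)
      =O[𝓝[>] (0 : ℝ)] fun x : ℝ => x ^ (N + 1) := by
  refine ((hφ.iteratedDeriv_infty i).taylor_isBigO N |>.mono nhdsWithin_le_nhds).congr' ?_
    Filter.EventuallyEq.rfl
  filter_upwards [hev.iteratedDeriv_nhdsGT i] with x hx
  rw [hx]
  congr 1
  refine Finset.sum_congr rfl fun j _ => ?_
  rw [scaledQuantileDerivZero_eq hφ hev, iteratedDeriv_eq_iterate, iteratedDeriv_eq_iterate,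
    iteratedDeriv_eq_iterate, add_comm i j, Function.iterate_add_apply]

theorem tripleSum_isBigO {p : ℝ} (hp0 : 0 < p) (hp1 : p < 1) {φ : ℝ → ℝ}
    (hφ : ContDiffAt ℝ ∞ φ 0) (hev : scaledQuantile p =ᶠ[𝓝[>] (0 : ℝ)] φ) (n : ℕ) :
    (fun x : ℝ => Real.exp (-(Real.log p / x)) * iteratedDeriv n (gammaQuantile p) x -
        ∑ k ∈ Finset.range (n + 1), ∑ l ∈ Finset.range (k + 1), ∑ j ∈ Finset.range (2 * k + 1),
          expansionTerm p n k l j / x ^ ((k : ℤ) + (l : ℤ) - (j : ℤ)))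
      =O[𝓝[>] (0 : ℝ)] fun x : ℝ => x := by
  have hterm : ∀ k ∈ Finset.range (n + 1), ∀ l ∈ Finset.range (k + 1),
      (fun x : ℝ => (n.choose k : ℝ) * expInvCoeff (l + k) k * (-Real.log p) ^ l / x ^ (k + l) *
        (iteratedDeriv (n - k) (scaledQuantile p) x - ∑ j ∈ Finset.range (2 * k + 1),
          scaledQuantileDerivZero p (n - k + j) / j.factorial * x ^ j))
      =O[𝓝[>] (0 : ℝ)] fun x : ℝ => x := by
    intro k _ l hl
    have hl' : l < k + 1 := Finset.mem_range.1 hl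
    have h1 : (fun x : ℝ => (n.choose k : ℝ) * expInvCoeff (l + k) k * (-Real.log p) ^ l /
        x ^ (k + l)) =O[𝓝[>] (0 : ℝ)] fun x : ℝ => (x ^ (k + l))⁻¹ :=
      Asymptotics.isBigO_const_mul_self _ _ _
    refine ((h1.mul (iteratedDeriv_scaledQuantile_taylor hφ hev (n - k) (2 * k))).trans ?_)
    -- As `l ≤ k`, the Taylor remainder `x^{2k+1}` beats `x^{-(k+l)}` by at least one power; this is
    -- why `j` stops at `2k`.
    refine (isBigO_pow_self_nhdsGT (m := 2 * k + 1 - (k + l)) (by omega)).congr' ?_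
      Filter.EventuallyEq.rfl
    filter_upwards [self_mem_nhdsWithin] with x hx
    rw [pow_sub₀ x (ne_of_gt hx) (by omega), mul_comm]
  refine (Asymptotics.IsBigO.fun_sum fun k hk => Asymptotics.IsBigO.fun_sum fun l hl =>
    hterm k hk l hl).congr' ?_ Filter.EventuallyEq.rfl
  filter_upwards [self_mem_nhdsWithin] with x hx
  rw [exp_mul_iteratedDeriv_gammaQuantile hp0 hp1 hx, ← Finset.sum_sub_distrib]
  refine Finset.sum_congr rfl fun k _ => ?_
  rw [← Finset.sum_sub_distrib]
  refine Finset.sum_congr rfl fun l _ => ?_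
  rw [mul_sub, Finset.mul_sum]
  congr 1
  exact Finset.sum_congr rfl fun j _ => (expansionTerm_div_zpow p n k l j (ne_of_gt hx)).symm

/-- A term with `j ≤ k + l` is counted exactly once, at `i = k + l - j ≤ 2n`; a term with `j > k +
l` carries a positive power of `x` and goes into the error. -/
theorem tripleSum_sub_sum_expansionCoeff_isBigO (p : ℝ) (n : ℕ) :
    (fun x : ℝ =>
        (∑ k ∈ Finset.range (n + 1), ∑ l ∈ Finset.range (k + 1), ∑ j ∈ Finset.range (2 * k + 1),
          expansionTerm p n k l j / x ^ ((k : ℤ) + (l : ℤ) - (j : ℤ))) -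
        ∑ i ∈ Finset.range (2 * n + 1), expansionCoeff p i n / x ^ i)
      =O[𝓝[>] (0 : ℝ)] fun x : ℝ => x := by
  have hterm : ∀ k ∈ Finset.range (n + 1), ∀ l ∈ Finset.range (k + 1),
      ∀ j ∈ Finset.range (2 * k + 1),
      (fun x : ℝ => expansionTerm p n k l j / x ^ ((k : ℤ) + (l : ℤ) - (j : ℤ)) -
        ∑ i ∈ Finset.range (2 * n + 1),
          (if k + l = i + j then expansionTerm p n k l j else 0) / x ^ i)
      =O[𝓝[>] (0 : ℝ)] fun x : ℝ => x := by
    intro k hk l hl j _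
    have hk' : k < n + 1 := Finset.mem_range.1 hk
    have hl' : l < k + 1 := Finset.mem_range.1 hl
    rcases le_or_gt j (k + l) with hj | hj
    · refine (Asymptotics.isBigO_zero _ _).congr_left fun x => ?_
      rw [Finset.sum_eq_single (k + l - j), if_pos (by omega), eq_comm, sub_eq_zero,
        ← zpow_natCast]
      · congr 2
        omega
      · intro i _ hi
        rw [if_neg (by omega), zero_div]
      · intro h
        exact absurd (Finset.mem_range.2 (by omega)) h
    · have h1 : (fun x : ℝ => expansionTerm p n k l j * x ^ (j - (k + l)))
          =O[𝓝[>] (0 : ℝ)] fun x : ℝ => x :=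
        (isBigO_pow_self_nhdsGT (by omega)).const_mul_left _
      refine h1.congr_left fun x => ?_
      rw [Finset.sum_eq_zero, sub_zero, div_eq_mul_inv, ← zpow_neg, ← zpow_natCast]
      · congr 2
        omega
      · intro i _
        rw [if_neg (by omega), zero_div]
  refine (Asymptotics.IsBigO.fun_sum fun k hk => Asymptotics.IsBigO.fun_sum fun l hl =>
    Asymptotics.IsBigO.fun_sum fun j hj => hterm k hk l hl j hj).congr_left fun x => ?_
  simp only [expansionCoeff, Finset.sum_div, Finset.sum_sub_distrib]
  congr 1
  symm
  rw [Finset.sum_comm]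
  refine Finset.sum_congr rfl fun k _ => ?_
  rw [Finset.sum_comm]
  refine Finset.sum_congr rfl fun l _ => ?_
  rw [Finset.sum_comm]

/-! ### Leading coefficients and leading behaviour. -/

theorem expansionTerm_diag (p : ℝ) (n j : ℕ) :
    expansionTerm p n n n j
      = (-Real.log p) ^ n * (scaledQuantileDerivZero p j / (j.factorial : ℝ)) := by
  rw [expansionTerm, expInvCoeff, ← two_mul, expInvPoly_coeff_two_mul]
  simp

/-- With `l ≤ k ≤ n`, `k + l - j = 2n` forces `k = l = n` and `j = 0`. -/
theorem expansionCoeff_two_mul (p : ℝ) (n : ℕ) :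
    expansionCoeff p (2 * n) n = scaledQuantileDerivZero p 0 * (-Real.log p) ^ n := by
  rw [expansionCoeff, Finset.sum_eq_single n, Finset.sum_eq_single n, Finset.sum_eq_single 0,
    if_pos (by omega), expansionTerm_diag]
  · simp [mul_comm]
  · intro j _ hj
    exact if_neg (by omega)
  · simp
  · intro l hl hln
    have := Finset.mem_range.1 hl
    exact Finset.sum_eq_zero fun j _ => if_neg (by omega)
  · simp
  · intro k hk hkn
    have := Finset.mem_range.1 hk
    refine Finset.sum_eq_zero fun l hl => Finset.sum_eq_zero fun j _ => if_neg ?_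
    have := Finset.mem_range.1 hl
    omega
  · simp

/-- Here `k = m + 1` is forced, since `k ≤ m` gives at most `2m`; what remains is `(l, j) = (m + 1,
1)` and `(m, 0)`. -/
theorem expansionCoeff_two_mul_add_one (p : ℝ) (m : ℕ) :
    expansionCoeff p (2 * m + 1) (m + 1)
      = (-Real.log p) ^ m * (-Real.log p * scaledQuantileDerivZero p 1 -
          ((m : ℝ) + 1) * m * scaledQuantileDerivZero p 0) := by
  rw [expansionCoeff, Finset.sum_eq_single (m + 1), Finset.sum_range_succ, Finset.sum_range_succ,
    Finset.sum_eq_zero, Finset.sum_eq_single 0, Finset.sum_eq_single 1, if_pos (by omega),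
    if_pos (by omega), expansionTerm_diag, expansionTerm, expInvCoeff,
    show m + (m + 1) = 2 * m + 1 by ring, expInvPoly_coeff_two_mul_add_one]
  · simp
    ring
  · intro j _ hj
    exact if_neg (by omega)
  · intro h
    exact absurd (Finset.mem_range.2 (by omega)) h
  · intro j _ hj
    exact if_neg (by omega)
  · intro h
    exact absurd (Finset.mem_range.2 (by omega)) h
  · intro l hl
    have := Finset.mem_range.1 hl
    exact Finset.sum_eq_zero fun j _ => if_neg (by omega)
  · intro k hk hkn
    have := Finset.mem_range.1 hk
    refine Finset.sum_eq_zero fun l hl => Finset.sum_eq_zero fun j _ => if_neg ?_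
    have := Finset.mem_range.1 hl
    omega
  · simp

/-- A function with an expansion in powers of `1 / x` is asymptotic to its leading term. -/
theorem tendsto_pow_mul_of_expansion {f : ℝ → ℝ} {z : ℕ → ℝ} {N : ℕ}
    (h : (fun x : ℝ => f x - ∑ i ∈ Finset.range (N + 1), z i / x ^ i)
      =O[𝓝[>] (0 : ℝ)] fun x : ℝ => x) :
    Filter.Tendsto (fun x => x ^ N * f x) (𝓝[>] 0) (𝓝 (z N)) := by
  have hid : Filter.Tendsto (fun x : ℝ => x) (𝓝[>] 0) (𝓝 0) :=
    tendsto_nhdsWithin_of_tendsto_nhds Filter.tendsto_id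
  have h1 : Filter.Tendsto (fun x : ℝ => x ^ N *
      (f x - ∑ i ∈ Finset.range (N + 1), z i / x ^ i)) (𝓝[>] 0) (𝓝 (0 ^ N * 0)) :=
    (hid.pow N).mul (h.trans_tendsto hid)
  have h2 : Filter.Tendsto (fun x : ℝ => ∑ i ∈ Finset.range (N + 1), z i * x ^ (N - i))
      (𝓝[>] 0) (𝓝 (∑ i ∈ Finset.range (N + 1), z i * 0 ^ (N - i))) :=
    tendsto_finsetSum _ fun i _ => (hid.pow (N - i)).const_mul (z i)
  have h3 : ∑ i ∈ Finset.range (N + 1), z i * (0 : ℝ) ^ (N - i) = z N := by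
    rw [Finset.sum_range_succ, Finset.sum_eq_zero]
    · simp
    · intro i hi
      have := Finset.mem_range.1 hi
      rw [zero_pow (by omega), mul_zero]
  have h4 := h1.add h2
  rw [h3, mul_zero, zero_add] at h4
  refine h4.congr' ?_
  filter_upwards [self_mem_nhdsWithin] with x hx
  have hx0 : x ≠ 0 := ne_of_gt hx
  rw [mul_sub, Finset.mul_sum, sub_add_eq_add_sub, add_sub_assoc, ← Finset.sum_sub_distrib,
    Finset.sum_eq_zero, add_zero]
  intro i hi
  have := Finset.mem_range.1 hi
  rw [pow_sub₀ x hx0 (by omega)]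
  ring

theorem mainTheorem2 (p : ℝ) (hp0 : 0 < p) (hp1 : p < 1) (n : ℕ) :
    -- `m_p` is smooth on `(0,∞)` and all derivatives of `u_p` have limits at `0`
    ContDiffOn ℝ ∞ (gammaQuantile p) (Set.Ioi 0) ∧
    (∀ j : ℕ, Filter.Tendsto (iteratedDeriv j (scaledQuantile p)) (𝓝[>] (0 : ℝ))
      (𝓝 (scaledQuantileDerivZero p j))) ∧
    -- the expansion as an explicit triple sum
    ((fun x : ℝ => Real.exp (-(Real.log p / x)) * iteratedDeriv n (gammaQuantile p) x -
        ∑ k ∈ Finset.range (n + 1), ∑ l ∈ Finset.range (k + 1), ∑ j ∈ Finset.range (2 * k + 1),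
          expansionTerm p n k l j / x ^ ((k : ℤ) + (l : ℤ) - (j : ℤ)))
      =O[𝓝[>] (0 : ℝ)] fun x : ℝ => x) ∧
    -- the expansion ordered by powers of `x`
    ((fun x : ℝ => Real.exp (-(Real.log p / x)) * iteratedDeriv n (gammaQuantile p) x -
        ∑ k ∈ Finset.range (2 * n + 1), expansionCoeff p k n / x ^ k)
      =O[𝓝[>] (0 : ℝ)] fun x : ℝ => x) ∧
    -- the leading coefficients
    expansionCoeff p (2 * n) n =
      Real.exp (-Real.eulerMascheroniConstant) * (-Real.log p) ^ n ∧
    (1 ≤ n → expansionCoeff p (2 * n - 1) n =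
      Real.exp (-Real.eulerMascheroniConstant) * (-Real.log p) ^ (n - 1) *
        (-(sConst 1) * Real.log p - (n : ℝ) * ((n : ℝ) - 1))) ∧
    -- the leading behaviour of the derivatives
    Asymptotics.IsEquivalent (𝓝[>] (0 : ℝ)) (iteratedDeriv n (gammaQuantile p))
      (fun x : ℝ => (-Real.log p) ^ n / x ^ (2 * n) *
        Real.exp (-Real.eulerMascheroniConstant) * Real.exp (Real.log p / x)) := by

  obtain ⟨φ, hφ, hφ0, hφ1, hev⟩ := exists_contDiffAt_eq_scaledQuantile hp0 hp1
  replace hev : scaledQuantile p =ᶠ[𝓝[>] (0 : ℝ)] φ := hev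
  have hu0 : scaledQuantileDerivZero p 0 = Real.exp (-Real.eulerMascheroniConstant) := by
    rw [scaledQuantileDerivZero_eq hφ hev, iteratedDeriv_zero, hφ0]
  have hu1 : scaledQuantileDerivZero p 1
      = Real.exp (-Real.eulerMascheroniConstant) * sConst 1 := by
    rw [scaledQuantileDerivZero_eq hφ hev, iteratedDeriv_one, hφ1.deriv, sConst_one]
  have htriple := tripleSum_isBigO hp0 hp1 hφ hev n
  have hpowers : (fun x : ℝ => Real.exp (-(Real.log p / x)) *
      iteratedDeriv n (gammaQuantile p) x -
        ∑ k ∈ Finset.range (2 * n + 1), expansionCoeff p k n / x ^ k)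
      =O[𝓝[>] (0 : ℝ)] fun x : ℝ => x :=
    (htriple.add (tripleSum_sub_sum_expansionCoeff_isBigO p n)).congr_left fun x => by ring
  have hlead : expansionCoeff p (2 * n) n
      = Real.exp (-Real.eulerMascheroniConstant) * (-Real.log p) ^ n := by
    rw [expansionCoeff_two_mul, hu0]
  refine ⟨fun x hx => (contDiffAt_gammaQuantile hp0 hp1 hx).contDiffWithinAt, fun j => ?_,
    htriple, hpowers, hlead, fun hn => ?_, ?_⟩
  · rw [scaledQuantileDerivZero_eq hφ hev]
    exact tendsto_iteratedDeriv_scaledQuantile hφ hev j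
  · obtain ⟨m, rfl⟩ := Nat.exists_eq_add_of_le' hn
    rw [show 2 * (m + 1) - 1 = 2 * m + 1 by omega, expansionCoeff_two_mul_add_one, hu0, hu1,
      Nat.add_sub_cancel]
    push_cast
    ring
  · have hL : -Real.log p ≠ 0 := (neg_pos.2 (Real.log_neg hp0 hp1)).ne'
    have hC : Real.exp (-Real.eulerMascheroniConstant) * (-Real.log p) ^ n ≠ 0 :=
      mul_ne_zero (Real.exp_ne_zero _) (pow_ne_zero _ hL)
    -- The leading coefficient is nonzero because `log p ≠ 0`, so dividing by it gives a ratio that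
    -- tends to `1`.
    have hlim := (tendsto_pow_mul_of_expansion hpowers).div_const
      (Real.exp (-Real.eulerMascheroniConstant) * (-Real.log p) ^ n)
    rw [hlead, div_self hC] at hlim
    refine Asymptotics.isEquivalent_of_tendsto_one (hlim.congr' ?_)
    filter_upwards [self_mem_nhdsWithin] with x hx
    have hx0 : x ≠ 0 := ne_of_gt hx
    rw [Pi.div_apply, Real.exp_neg (Real.log p / x)]
    field_simp
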